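/- For $n\ge 1$ let $\overline{\mathbb S}_n$ be the set of all finite sequences $s_0\dots s_{k-1}$ (including the empty one) with entries in $\{0,\dots,n-1\}$ such that $s_{i+1}\le s_i+1$ for all $i<k-1$. Order it by weak gap-embeddability: $s_0\dots s_{k-1}\le^w_{gap}s'_0\dots s'_{l-1}$ if and only if there is a strictly increasing $f:\{0,\dots,k-1\}\to\{0,\dots,l-1\}$ such that $s_i=s'_{f(i)}$ for all $i\le k-1$, and $s'_j\ge s_{i+1}$ for all $i<k-1$ and all $j$ with $f(i)<j<f(i+1)$. Write $\overline{\mathbb S}_n^w$ for the resulting partial order. For a well-partial-order $X$, let its maximal order type $o(X)$ be the supremum of the order types of all well-orders on the set $X$ that extend the order of $X$. Let $\omega_0=1$ and $\omega_{m+1}=\omega^{\omega_m}$. **Corollary.** For every $n\ge 1$, $\overline{\mathbb S}_n^w$ is a well-partial-order and $o(\overline{\mathbb S}_n^w)=\omega_{2n-1}$. -/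

import Mathlib

universe u

/-- The order types of the well-orders on `X` that extend the order of `X`. Here `r` is the
strict part of the well-order. -/
def extensionTypes (X : Type u) [PartialOrder X] : Set Ordinal.{u} :=
  {α | ∃ (r : X → X → Prop) (h : IsWellOrder X r),
    (∀ x y : X, x ≤ y → x = y ∨ r x y) ∧ @Ordinal.type X r h = α}

theorem bddAbove_extensionTypes (X : Type u) [PartialOrder X] :
    BddAbove (extensionTypes X) := by
  refine ⟨(Order.succ (Cardinal.mk X)).ord, ?_⟩
  rintro _ ⟨r, h, -, rfl⟩
  refine le_of_lt (Cardinal.lt_ord.2 ?_)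
  rw [Ordinal.card_type]
  exact Order.lt_succ _

/-- The maximal order type of a partial order `X`: the supremum of the order types of the
well-orders on `X` that extend the order of `X`. The set of these order types is always
bounded, see `bddAbove_extensionTypes`. -/
noncomputable def maxOrderType (X : Type u) [PartialOrder X] : Ordinal.{u} :=
  sSup (extensionTypes X)

/-- The tower `ω_n[α]`: `ω_0[α] = α` and `ω_{n+1}[α] = ω ^ ω_n[α]`. -/
noncomputable def omegaTowerOn (α : Ordinal.{u}) : ℕ → Ordinal.{u}
  | 0 => α
  | n + 1 => Ordinal.omega0 ^ omegaTowerOn α n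

/-- The tower `ω_n = ω_n[1]`. -/
noncomputable def omegaTower (n : ℕ) : Ordinal.{u} := omegaTowerOn 1 n

/-- Weak gap-embeddability of finite sequences with entries in `{0, …, n-1}`. -/
def WeakGapEmb {n : ℕ} (s t : List (Fin n)) : Prop :=
  ∃ f : Fin s.length → Fin t.length, StrictMono f ∧
    (∀ i, s.get i = t.get (f i)) ∧
    ∀ (i : ℕ) (hi : i + 1 < s.length) (j : Fin t.length),
      f ⟨i, Nat.lt_of_succ_lt hi⟩ < j → j < f ⟨i + 1, hi⟩ → s.get ⟨i + 1, hi⟩ ≤ t.get j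

theorem WeakGapEmb.refl {n : ℕ} (s : List (Fin n)) : WeakGapEmb s s := by
  refine ⟨id, strictMono_id, fun _ => rfl, fun i hi j h1 h2 => ?_⟩
  simp only [id, Fin.lt_def] at h1 h2
  omega

theorem WeakGapEmb.sublist {n : ℕ} {s t : List (Fin n)} (h : WeakGapEmb s t) :
    List.Sublist s t := by
  obtain ⟨f, hf, he, -⟩ := h
  exact List.sublist_iff_exists_fin_orderEmbedding_get_eq.2
    ⟨OrderEmbedding.ofStrictMono f hf, he⟩

theorem WeakGapEmb.antisymm {n : ℕ} {s t : List (Fin n)} (h : WeakGapEmb s t)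
    (h' : WeakGapEmb t s) : s = t :=
  h.sublist.antisymm h'.sublist

theorem WeakGapEmb.trans {n : ℕ} {s t v : List (Fin n)} (h : WeakGapEmb s t)
    (h' : WeakGapEmb t v) : WeakGapEmb s v := by
  obtain ⟨f, hf, he, hg⟩ := h
  obtain ⟨g, kf, ke, kg⟩ := h'
  refine ⟨g ∘ f, kf.comp hf, fun i => (he i).trans (ke _), fun i hi j h1 h2 => ?_⟩
  have key : ∀ (c : Fin n) (a : Fin t.length) (b : ℕ) (hb : b < t.length),
      (∀ m : Fin t.length, a < m → m ≤ ⟨b, hb⟩ → c ≤ t.get m) →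
      g a < j → j < g ⟨b, hb⟩ → c ≤ v.get j := by
    intro c a b
    induction b with
    | zero =>
      intro hb _ h1 h2
      have := kf.lt_iff_lt.1 (h1.trans h2)
      simp [Fin.lt_def] at this
    | succ b ih =>
      intro hb hc h1 h2
      have hab := kf.lt_iff_lt.1 (h1.trans h2)
      have hb' : b < t.length := Nat.lt_of_succ_lt hb
      have hle : a ≤ ⟨b, hb'⟩ := by
        simp only [Fin.lt_def, Fin.le_def] at hab ⊢
        omega
      rcases lt_trichotomy j (g ⟨b, hb'⟩) with h3 | h3 | h3
      · refine ih hb' (fun m hm hm' => hc m hm (hm'.trans ?_)) h1 h3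
        simp [Fin.le_def]
      · rw [h3, ← ke]
        refine hc _ ?_ ?_
        · rw [h3] at h1
          exact kf.lt_iff_lt.1 h1
        · simp [Fin.le_def]
      · exact (hc _ hab le_rfl).trans (kg b hb j h3 h2)
  refine key _ (f ⟨i, Nat.lt_of_succ_lt hi⟩) (f ⟨i + 1, hi⟩) (f ⟨i + 1, hi⟩).2 ?_ h1 h2
  intro m hm hm'
  rcases lt_or_eq_of_le hm' with h3 | h3
  · exact hg i hi m hm h3
  · rw [h3, he]

/-- The finite sequences with entries in `{0, …, n-1}` whose entries rise by at most one
at each step. -/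
@[ext]
structure RestrictedSeq (n : ℕ) where
  /-- the underlying sequence -/
  toList : List (Fin n)
  /-- each entry is at most the preceding entry plus one -/
  rise_le_one : ∀ (i : ℕ) (hi : i + 1 < toList.length),
    (toList.get ⟨i + 1, hi⟩ : ℕ) ≤ (toList.get ⟨i, Nat.lt_of_succ_lt hi⟩ : ℕ) + 1

/-- The restricted sequences are ordered by weak gap-embeddability. -/
instance RestrictedSeq.instPartialOrder (n : ℕ) : PartialOrder (RestrictedSeq n) where
  le s t := WeakGapEmb s.toList t.toList
  le_refl s := WeakGapEmb.refl s.toList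
  le_trans _ _ _ h h' := h.trans h'
  le_antisymm _ _ h h' := RestrictedSeq.ext (h.antisymm h')

/-! Cutting a restricted word at the occurrences of its least letter leaves blocks that are
restricted words over one letter fewer, and the weak gap order turns into Higman's order on lists of
blocks. Iterating, words over `k + 1` letters are compared with `HigSeq k`, the `k`-fold Higman
iteration over the natural numbers. The two orders need not be isomorphic: it is enough that there
are maps in both directions that reflect the order (`HigSeq.exists_dec`,
`HigSeq.le_of_weakGap_enc`). A Higman step takes `α` to `ω ^ ω ^ α` for the `α` that occur, all
below the first epsilon number. Starting from `ω`, this gives a tower of height `2 * k + 1`.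

Upper bound: `ResidualBound` measures the tree of bad sequences, pulls back along reflecting maps,
implies well-quasi-ordering and bounds every linear extension (`ResidualBound.type_le`). For
Higman's order, the words not above a given word lie in a finite union of products of simpler
languages, whose sizes are added by natural sums (`ResidualBound.sublistForall₂`).

Lower bound: letters act on ordinals by monotone inflationary maps, and words thereby take every
nonzero value below `ω ^ ω ^ α` (`exists_wordAct_eq`). A supremum over encoded sequences carries
this value to restricted words, and `le_maxOrderType` turns a monotone map with enough values into a
long well-order. -/

/-! ### Natural sums and their closure below powers of `ω`. -/

/-- The natural (Hessenberg) sum of two ordinals. -/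
noncomputable def natSum (a b : Ordinal.{u}) : Ordinal.{u} :=
  max (⨆ x : Set.Iio a, Order.succ (natSum x.1 b)) (⨆ x : Set.Iio b, Order.succ (natSum a x.1))
termination_by (a, b)
decreasing_by
  · exact Prod.Lex.left _ _ x.2
  · exact Prod.Lex.right _ x.2

namespace natSum

open Ordinal

variable {a b c a' b' x : Ordinal.{u}}

theorem lt_iff : x < natSum a b ↔
    (∃ a' < a, x ≤ natSum a' b) ∨ ∃ b' < b, x ≤ natSum a b' := by
  rw [natSum, lt_max_iff, Ordinal.lt_iSup_iff, Ordinal.lt_iSup_iff]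
  simp

theorem lt_left (b : Ordinal.{u}) (h : a' < a) : natSum a' b < natSum a b :=
  lt_iff.2 (Or.inl ⟨a', h, le_rfl⟩)

theorem lt_right (a : Ordinal.{u}) (h : b' < b) : natSum a b' < natSum a b :=
  lt_iff.2 (Or.inr ⟨b', h, le_rfl⟩)

theorem le_left (b : Ordinal.{u}) (h : a' ≤ a) : natSum a' b ≤ natSum a b := by
  rcases h.eq_or_lt with rfl | h
  exacts [le_rfl, (lt_left b h).le]

theorem le_right (a : Ordinal.{u}) (h : b' ≤ b) : natSum a b' ≤ natSum a b := by
  rcases h.eq_or_lt with rfl | h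
  exacts [le_rfl, (lt_right a h).le]

protected theorem assoc (a b c : Ordinal.{u}) :
    natSum (natSum a b) c = natSum a (natSum b c) := by
  induction a using WellFoundedLT.induction generalizing b c with | _ a iha =>
  induction b using WellFoundedLT.induction generalizing c with | _ b ihb =>
  induction c using WellFoundedLT.induction with | _ c ihc =>
  refine eq_of_forall_lt_iff fun x => ⟨fun h => ?_, fun h => ?_⟩
  · rcases lt_iff.1 h with ⟨y, hy, hx⟩ | ⟨c', hc, hx⟩
    · rcases lt_iff.1 hy with ⟨a', ha, hy⟩ | ⟨b', hb, hy⟩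
      · refine (hx.trans (le_left c hy)).trans_lt ?_
        rw [iha a' ha]
        exact lt_left _ ha
      · refine (hx.trans (le_left c hy)).trans_lt ?_
        rw [ihb b' hb]
        exact lt_right _ (lt_left _ hb)
    · rw [ihc c' hc] at hx
      exact hx.trans_lt (lt_right _ (lt_right _ hc))
  · rcases lt_iff.1 h with ⟨a', ha, hx⟩ | ⟨y, hy, hx⟩
    · rw [← iha a' ha] at hx
      exact hx.trans_lt (lt_left _ (lt_left _ ha))
    · rcases lt_iff.1 hy with ⟨b', hb, hy⟩ | ⟨c', hc, hy⟩
      · refine (hx.trans (le_right a hy)).trans_lt ?_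
        rw [← ihb b' hb]
        exact lt_left _ (lt_right _ hb)
      · refine (hx.trans (le_right a hy)).trans_lt ?_
        rw [← ihc c' hc]
        exact lt_right _ hc

@[simp] theorem zero_left (b : Ordinal.{u}) : natSum 0 b = b := by
  induction b using WellFoundedLT.induction with | _ b ih =>
  refine eq_of_forall_lt_iff fun x => ⟨fun h => ?_, fun h => lt_iff.2 (Or.inr ⟨x, h, (ih x h).ge⟩)⟩
  rcases lt_iff.1 h with ⟨a', ha, -⟩ | ⟨b', hb, hx⟩
  · exact absurd ha not_lt_zero
  · exact (hx.trans (ih b' hb).le).trans_lt hb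

@[simp] theorem zero_right (a : Ordinal.{u}) : natSum a 0 = a := by
  induction a using WellFoundedLT.induction with | _ a ih =>
  refine eq_of_forall_lt_iff fun x => ⟨fun h => ?_, fun h => lt_iff.2 (Or.inl ⟨x, h, (ih x h).ge⟩)⟩
  rcases lt_iff.1 h with ⟨a', ha, hx⟩ | ⟨b', hb, -⟩
  · exact (hx.trans (ih a' ha).le).trans_lt ha
  · exact absurd hb not_lt_zero

/-- The natural sum is bounded by adding leading coefficients and remainders. -/
theorem opow_mul_add_le {γ : Ordinal.{u}} (hγ : ∀ r < ω ^ γ, ∀ s < ω ^ γ, natSum r s < ω ^ γ)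
    (m k : ℕ) {r s : Ordinal.{u}} (hr : r < ω ^ γ) (hs : s < ω ^ γ) :
    natSum (ω ^ γ * m + r) (ω ^ γ * k + s) ≤ ω ^ γ * (m + k : ℕ) + natSum r s := by
  have hpos : (0 : Ordinal.{u}) < ω ^ γ := opow_pos γ omega0_pos
  -- Division by `ω ^ γ`: a smaller ordinal has a smaller coefficient, or the same coefficient and a
  -- smaller remainder.
  have step : ∀ (m : ℕ) (r a : Ordinal.{u}), r < ω ^ γ → a < ω ^ γ * m + r →
      ∃ (m' : ℕ) (r' : Ordinal.{u}), r' < ω ^ γ ∧ a = ω ^ γ * m' + r' ∧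
        (m' < m ∨ m' = m ∧ r' < r) := by
    intro m r a hr ha
    have hd : a / ω ^ γ < (m + 1 : ℕ) := by
      rw [← Ordinal.lt_mul_iff_div_lt hpos.ne', Nat.cast_add, Nat.cast_one, mul_add_one]
      exact ha.trans (by gcongr)
    obtain ⟨m', hm'⟩ := lt_omega0.1 (hd.trans (natCast_lt_omega0 _))
    have haeq := Ordinal.div_add_mod a (ω ^ γ)
    rw [hm'] at hd haeq
    have hlt : m' < m + 1 := by exact_mod_cast hd
    refine ⟨m', a % ω ^ γ, Ordinal.mod_lt _ hpos.ne', haeq.symm, ?_⟩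
    rcases Nat.lt_succ_iff_lt_or_eq.1 hlt with h | rfl
    · exact Or.inl h
    · refine Or.inr ⟨rfl, ?_⟩
      rw [← haeq] at ha
      exact lt_of_add_lt_add_left ha
  have drop : ∀ {p q : ℕ} {t u : Ordinal.{u}}, p < q → t < ω ^ γ →
      ω ^ γ * (p : ℕ) + t < ω ^ γ * (q : ℕ) + u := by
    intro p q t u hpq ht
    calc ω ^ γ * (p : ℕ) + t < ω ^ γ * (p : ℕ) + ω ^ γ := by gcongr
      _ = ω ^ γ * (p + 1 : ℕ) := by rw [Nat.cast_add, Nat.cast_one, mul_add_one]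
      _ ≤ ω ^ γ * (q : ℕ) := by gcongr; exact_mod_cast hpq
      _ ≤ _ := le_self_add
  generalize ha : ω ^ γ * (m : Ordinal.{u}) + r = a
  generalize hb : ω ^ γ * (k : Ordinal.{u}) + s = b
  induction a using WellFoundedLT.induction generalizing m k r s b with | _ a iha =>
  induction b using WellFoundedLT.induction generalizing m k r s with | _ b ihb =>
  refine le_of_forall_lt fun x hx => ?_
  rcases lt_iff.1 hx with ⟨a', ha', hx⟩ | ⟨b', hb', hx⟩
  · refine hx.trans_lt ?_
    obtain ⟨m', r', hr', he, h⟩ := step m r a' hr (ha ▸ ha')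
    refine (iha a' ha' m' k hr' hs he.symm b hb).trans_lt ?_
    rcases h with h | ⟨rfl, h⟩
    · exact drop (by omega) (hγ _ hr' _ hs)
    · have := lt_left s h
      gcongr
  · refine hx.trans_lt ?_
    obtain ⟨k', s', hs', he, h⟩ := step k s b' hs (hb ▸ hb')
    refine (ihb b' hb' m k' hr hs' ha he.symm).trans_lt ?_
    rcases h with h | ⟨rfl, h⟩
    · exact drop (by omega) (hγ _ hr _ hs')
    · have := lt_right r h
      gcongr

/-- With `γ` the larger leading exponent, both coefficients at `ω ^ γ` are finite, and the natural
sum of the remainders stays below `ω ^ γ` by induction. -/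
theorem lt_omega0_opow {e : Ordinal.{u}} : ∀ {a b : Ordinal.{u}}, a < ω ^ e → b < ω ^ e →
    natSum a b < ω ^ e := by
  induction e using WellFoundedLT.induction with | _ e ih =>
  intro a b ha hb
  rcases eq_or_ne a 0 with rfl | ha0
  · simpa using hb
  rcases eq_or_ne b 0 with rfl | hb0
  · simpa using ha
  set γ := max (log ω a) (log ω b) with hγ
  have hγe : γ < e := max_lt ((lt_opow_iff_log_lt one_lt_omega0 ha0).1 ha)
    ((lt_opow_iff_log_lt one_lt_omega0 hb0).1 hb)
  have hpos : (ω ^ γ : Ordinal.{u}) ≠ 0 := opow_ne_zero _ omega0_ne_zero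
  have coef : ∀ c : Ordinal.{u}, log ω c ≤ γ → ∃ m : ℕ, c / ω ^ γ = m := by
    intro c hc
    refine lt_omega0.1 ((Ordinal.lt_mul_iff_div_lt hpos).1 ?_)
    rw [← opow_succ]
    exact lt_opow_of_log_lt one_lt_omega0 (Order.lt_succ_of_le hc)
  obtain ⟨m, hm⟩ := coef a (le_max_left _ _)
  obtain ⟨k, hk⟩ := coef b (le_max_right _ _)
  have hp : ∀ r < (ω ^ γ : Ordinal.{u}), ∀ s < (ω ^ γ : Ordinal.{u}), natSum r s < ω ^ γ :=
    fun r hr s hs => ih γ hγe hr hs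
  have hr := Ordinal.mod_lt a hpos
  have hs := Ordinal.mod_lt b hpos
  have key := opow_mul_add_le hp m k hr hs
  rw [← hm, ← hk, Ordinal.div_add_mod, Ordinal.div_add_mod] at key
  exact key.trans_lt (opow_mul_add_lt_opow (natCast_lt_omega0 _) (hp _ hr _ hs) hγe)

end natSum

/-! ### Heights of trees of bad sequences. -/

/-- `ResidualBound r α A` says that the tree of `r`-bad sequences in `A` has height at most `α`. -/
def ResidualBound {X : Type*} (r : X → X → Prop) (α : Ordinal.{u}) (A : Set X) : Prop :=
  ∀ x ∈ A, ∃ β, ∃ _ : β < α, ResidualBound r β {y ∈ A | ¬ r x y}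
termination_by α

namespace ResidualBound

variable {X Y : Type*} {r : X → X → Prop} {α β : Ordinal.{u}} {A B : Set X}

theorem iff : ResidualBound r α A ↔
    ∀ x ∈ A, ∃ β < α, ResidualBound r β {y ∈ A | ¬ r x y} := by
  rw [ResidualBound]
  simp only [exists_prop]

/-- Bounds pull back along maps that reflect the relation. -/
theorem comap {s : Y → Y → Prop} {B : Set Y} (h : ResidualBound s α B) (e : X → Y)
    (he : Set.MapsTo e A B) (hr : ∀ x ∈ A, ∀ y ∈ A, s (e x) (e y) → r x y) :
    ResidualBound r α A := by
  induction α using WellFoundedLT.induction generalizing A B with | _ α ih =>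
  refine iff.2 fun x hx => ?_
  obtain ⟨β, hβ, hb⟩ := iff.1 h (e x) (he hx)
  exact ⟨β, hβ, ih β hβ hb (fun y hy => ⟨he hy.1, fun hs => hy.2 (hr x hx y hy.1 hs)⟩)
    fun y hy z hz => hr y hy.1 z hz.1⟩

theorem mono_set (h : ResidualBound r α A) (hBA : B ⊆ A) : ResidualBound r α B :=
  h.comap id hBA fun _ _ _ _ hs => hs

/-- Choosing a point of one set lowers that set's bound and leaves the other alone; the natural sum
is strictly monotone in each argument. -/
theorem union (hA : ResidualBound r α A) (hB : ResidualBound r β B) :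
    ResidualBound r (natSum α β) (A ∪ B) := by
  induction α using WellFoundedLT.induction generalizing β A B with | _ α iha =>
  induction β using WellFoundedLT.induction generalizing B with | _ β ihb =>
  refine iff.2 fun x hx => ?_
  rcases hx with hx | hx
  · obtain ⟨γ, hγ, hb⟩ := iff.1 hA x hx
    exact ⟨_, natSum.lt_left β hγ, (iha γ hγ hb hB).mono_set fun y hy => hy.1.imp (⟨·, hy.2⟩) id⟩
  · obtain ⟨γ, hγ, hb⟩ := iff.1 hB x hx
    exact ⟨_, natSum.lt_right α hγ, (ihb γ hγ hb).mono_set fun y hy => hy.1.imp id (⟨·, hy.2⟩)⟩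

theorem empty : ResidualBound r α (∅ : Set X) :=
  iff.2 fun _ hx => hx.elim

/-- A finite union of sets with bounds below a power of `ω` has a bound below that power. -/
theorem exists_biUnion_list {ι : Type*} {e : Ordinal.{u}} {S : ι → Set X} (l : List ι)
    (h : ∀ i ∈ l, ∃ γ < Ordinal.omega0 ^ e, ResidualBound r γ (S i)) :
    ∃ γ < Ordinal.omega0 ^ e, ResidualBound r γ {x | ∃ i ∈ l, x ∈ S i} := by
  induction l with
  | nil => exact ⟨0, Ordinal.opow_pos e Ordinal.omega0_pos, empty.mono_set (by simp)⟩
  | cons i l ih =>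
    obtain ⟨γ, hγ, hb⟩ := ih fun j hj => h j (List.mem_cons_of_mem _ hj)
    obtain ⟨δ, hδ, hd⟩ := h i List.mem_cons_self
    refine ⟨_, natSum.lt_omega0_opow hδ hγ, (hd.union hb).mono_set ?_⟩
    rintro x ⟨j, hj, hx⟩
    rcases List.mem_cons.1 hj with rfl | hj
    exacts [Or.inl hx, Or.inr ⟨j, hj, hx⟩]

theorem exists_rel (h : ResidualBound r α A) (f : ℕ → X) (hf : ∀ n, f n ∈ A) :
    ∃ m n, m < n ∧ r (f m) (f n) := by
  induction α using WellFoundedLT.induction generalizing A f with | _ α ih =>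
  obtain ⟨β, hβ, hb⟩ := iff.1 h (f 0) (hf 0)
  by_cases hex : ∃ n, r (f 0) (f (n + 1))
  · obtain ⟨n, hn⟩ := hex
    exact ⟨0, n + 1, n.succ_pos, hn⟩
  · push Not at hex
    obtain ⟨m, n, hmn, hr⟩ := ih β hβ hb (fun n => f (n + 1)) fun n => ⟨hf _, hex n⟩
    exact ⟨m + 1, n + 1, by omega, hr⟩

theorem wellQuasiOrdered (h : ResidualBound r α Set.univ) : WellQuasiOrdered r :=
  fun f => h.exists_rel f fun _ => Set.mem_univ _

/-- A residual bound bounds the type of every well-order extending the relation. -/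
theorem type_le {X : Type u} {r : X → X → Prop} {α : Ordinal.{u}}
    (h : ResidualBound r α Set.univ) (s : X → X → Prop) [IsWellOrder X s]
    (hs : ∀ x y, r x y → x = y ∨ s x y) : Ordinal.type s ≤ α := by
  -- Whatever precedes `y` in the extension cannot lie above `y` in the original relation, so
  -- initial segments lie in residuals.
  have residual : ∀ {A : Set X} {x y : X}, s y x → {z | s z x} ⊆ A →
      {z | s z y} ⊆ {z ∈ A | ¬ r y z} := by
    intro A x y hyx hA z hz
    refine ⟨hA (_root_.trans hz hyx), fun hr => ?_⟩
    rcases hs y z hr with rfl | h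
    · exact irrefl_of s _ hz
    · exact asymm_of s hz h
  have key : ∀ (γ : Ordinal.{u}) (x : X), ResidualBound r γ {y | s y x} →
      Ordinal.typein s x ≤ γ := by
    intro γ
    induction γ using WellFoundedLT.induction with | _ γ ih =>
    intro x hx
    refine le_of_forall_lt fun o ho => ?_
    obtain ⟨y, rfl⟩ := Ordinal.typein_surj s (ho.trans (Ordinal.typein_lt_type s x))
    have hyx := (Ordinal.typein_lt_typein s).1 ho
    obtain ⟨δ, hδ, hb⟩ := iff.1 hx y hyx
    exact (ih δ hδ y (hb.mono_set (residual hyx subset_rfl))).trans_lt hδ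
  refine le_of_forall_lt fun o ho => ?_
  obtain ⟨y, rfl⟩ := Ordinal.typein_surj s ho
  obtain ⟨δ, hδ, hb⟩ := iff.1 h y (Set.mem_univ y)
  refine (key δ y (hb.mono_set fun z hz => ⟨Set.mem_univ z, fun hr => ?_⟩)).trans_lt hδ
  rcases hs y z hr with rfl | h
  · exact irrefl_of s _ hz
  · exact asymm_of s hz h

end ResidualBound

open Ordinal

/-! ### The upper bound for Higman's order. -/

section Atoms

variable {X : Type*}

/-- A basic language over `X` with an ordinal label: all words over a set of letters, or the
words of length at most one over a set of letters. -/
inductive WordAtom (X : Type*) : Type _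
  | star (A : Set X) (β : Ordinal.{u})
  | opt (A : Set X) (β : Ordinal.{u})

namespace WordAtom

/-- The language of an atom. -/
def lang : WordAtom.{u} X → Set (List X)
  | star A _ => {l | ∀ x ∈ l, x ∈ A}
  | opt A _ => {l | l = [] ∨ ∃ x ∈ A, l = [x]}

/-- The size of an atom. -/
noncomputable def size : WordAtom.{u} X → Ordinal.{u}
  | star _ β => ω ^ β
  | opt _ β => β

/-- The label of an atom bounds its set of letters and is at most `α`. -/
def Valid (r : X → X → Prop) (α : Ordinal.{u}) : WordAtom.{u} X → Prop
  | star A β => β ≤ α ∧ ResidualBound r β A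
  | opt A β => β ≤ α ∧ ResidualBound r β A

/-- The concatenation of the languages of a list of atoms. -/
def listLang : List (WordAtom.{u} X) → Set (List X)
  | [] => {[]}
  | a :: P => {l | ∃ u ∈ a.lang, ∃ v ∈ listLang P, l = u ++ v}

/-- The natural sum of the sizes of a list of atoms. -/
noncomputable def listSize : List (WordAtom.{u} X) → Ordinal.{u}
  | [] => 0
  | a :: P => natSum a.size (listSize P)

theorem listSize_append (P Q : List (WordAtom.{u} X)) :
    listSize (P ++ Q) = natSum (listSize P) (listSize Q) := by
  induction P with
  | nil => simp [listSize]
  | cons a P ih => simp [listSize, ih, natSum.assoc]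

theorem append_mem_listLang {P Q : List (WordAtom.{u} X)} {u v : List X}
    (hu : u ∈ listLang P) (hv : v ∈ listLang Q) : u ++ v ∈ listLang (P ++ Q) := by
  induction P generalizing u with
  | nil =>
    obtain rfl : u = [] := hu
    exact hv
  | cons a P ih =>
    obtain ⟨u₁, h₁, u₂, h₂, rfl⟩ := hu
    exact ⟨u₁, h₁, u₂ ++ v, ih h₂, List.append_assoc _ _ _⟩

theorem nil_mem_lang (a : WordAtom.{u} X) : [] ∈ a.lang := by
  cases a <;> simp [lang]

theorem nil_mem_listLang (P : List (WordAtom.{u} X)) : [] ∈ listLang P := by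
  induction P with
  | nil => rfl
  | cons a P ih => exact ⟨[], a.nil_mem_lang, [], ih, rfl⟩

end WordAtom

end Atoms

theorem List.SublistForall₂.append {X Y : Type*} {r : X → Y → Prop} {l₁ l₂ : List X}
    {m₁ m₂ : List Y} (h : List.SublistForall₂ r l₁ m₁) (h' : List.SublistForall₂ r l₂ m₂) :
    List.SublistForall₂ r (l₁ ++ l₂) (m₁ ++ m₂) := by
  induction h with
  | @nil l =>
    induction l with
    | nil => exact h'
    | cons a l ih => exact .cons_right ih
  | cons hr _ ih => exact .cons hr ih
  | cons_right _ ih => exact .cons_right ih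

namespace WordAtom

variable {X : Type*} {r : X → X → Prop} {α β : Ordinal.{u}} {A : Set X}

/-- The words over `A` not above a fixed word form a concatenation of smaller atoms. -/
theorem exists_star_residual (hα : ∀ γ ≤ α, γ < ω ^ γ) (hβ : β ≤ α) (hA : ResidualBound r β A)
    (u : List X) (hu : ∀ x ∈ u, x ∈ A) :
    ∃ P : List (WordAtom.{u} X), (∀ a ∈ P, a.Valid r α) ∧ listSize P < ω ^ β ∧
      ∀ v : List X, (∀ x ∈ v, x ∈ A) → ¬ List.SublistForall₂ r u v → v ∈ listLang P := by
  induction u with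
  | nil =>
    exact ⟨[], by simp, opow_pos β omega0_pos, fun v _ h => (h .nil).elim⟩
  | cons x u ih =>
    obtain ⟨P, hP, hs, hl⟩ := ih fun y hy => hu y (List.mem_cons_of_mem _ hy)
    obtain ⟨γ, hγ, hb⟩ := ResidualBound.iff.1 hA x (hu x List.mem_cons_self)
    -- Cut `v` at its first letter above `x`: the letters before it avoid `x`, then comes that
    -- single letter, and the rest is not above `u`.
    refine ⟨star {y ∈ A | ¬ r x y} γ :: opt A β :: P, ?_, ?_, ?_⟩
    · rintro a (_ | ⟨_, _ | ⟨_, ha⟩⟩)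
      exacts [⟨hγ.le.trans hβ, hb⟩, ⟨hβ, hA⟩, hP a ha]
    -- The single letter has size `β`, so `β < ω ^ β` is needed here; this is where epsilon numbers
    -- are excluded.
    · exact natSum.lt_omega0_opow ((opow_lt_opow_iff_right one_lt_omega0).2 hγ)
        (natSum.lt_omega0_opow (hα β hβ) hs)
    · intro v hv hn
      suffices h : (∀ y ∈ v, ¬ r x y) ∨
          ∃ v₀ y v₁, v = v₀ ++ y :: v₁ ∧ (∀ z ∈ v₀, ¬ r x z) ∧ r x y by
        rcases h with h | ⟨v₀, y, v₁, rfl, h, hr⟩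
        · exact ⟨v, fun y hy => ⟨hv y hy, h y hy⟩, [], nil_mem_listLang _, by simp⟩
        · simp only [List.mem_append, List.mem_cons] at hv
          refine ⟨v₀, fun z hz => ⟨hv z (Or.inl hz), h z hz⟩, y :: v₁,
            ⟨[y], Or.inr ⟨y, hv y (by simp), rfl⟩, v₁, ?_, rfl⟩, rfl⟩
          refine hl v₁ (fun z hz => hv z (by simp [hz])) fun hs => hn ?_
          exact List.SublistForall₂.append (l₁ := []) .nil (.cons hr hs)
      clear hv hn
      induction v with
      | nil => simp
      | cons y v ih =>
        by_cases hy : r x y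
        · exact Or.inr ⟨[], y, v, rfl, by simp, hy⟩
        · rcases ih with h | ⟨v₀, z, v₁, rfl, h, hz⟩
          · exact Or.inl (by simpa [hy] using h)
          · exact Or.inr ⟨y :: v₀, z, v₁, rfl, by simpa [hy] using h, hz⟩

theorem exists_residual (hα : ∀ γ ≤ α, γ < ω ^ γ) (a : WordAtom.{u} X) (ha : a.Valid r α)
    (u : List X) (hu : u ∈ a.lang) :
    ∃ Q : List (List (WordAtom.{u} X)),
      (∀ P ∈ Q, (∀ b ∈ P, b.Valid r α) ∧ listSize P < a.size) ∧
      ∀ v ∈ a.lang, ¬ List.SublistForall₂ r u v → ∃ P ∈ Q, v ∈ listLang P := by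
  cases a with
  | star A β =>
    obtain ⟨P, hP, hs, hl⟩ := exists_star_residual hα ha.1 ha.2 u hu
    exact ⟨[P], by simpa using ⟨hP, hs⟩, fun v hv hn => ⟨P, by simp, hl v hv hn⟩⟩
  | opt A β =>
    rcases hu with rfl | ⟨x, hx, rfl⟩
    · exact ⟨[], by simp, fun v _ h => (h .nil).elim⟩
    · obtain ⟨γ, hγ, hb⟩ := ResidualBound.iff.1 ha.2 x hx
      refine ⟨[[opt {y ∈ A | ¬ r x y} γ]], ?_, fun v hv hn => ⟨_, List.mem_singleton_self _, ?_⟩⟩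
      · simpa [listSize, size] using ⟨⟨hγ.le.trans ha.1, hb⟩, hγ⟩
      · refine ⟨v, ?_, [], rfl, by simp⟩
        rcases hv with rfl | ⟨y, hy, rfl⟩
        · exact Or.inl rfl
        · exact Or.inr ⟨y, ⟨hy, fun hr => hn (.cons hr .nil)⟩, rfl⟩

/-- If a product of words is not above another, factor by factor, then some factor fails to be above
its counterpart. Replacing that factor's atom by its residual decreases the natural sum. -/
theorem exists_list_residual (hα : ∀ γ ≤ α, γ < ω ^ γ) (P : List (WordAtom.{u} X))
    (hP : ∀ a ∈ P, a.Valid r α) (w : List X) (hw : w ∈ listLang P) :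
    ∃ Q : List (List (WordAtom.{u} X)),
      (∀ P' ∈ Q, (∀ b ∈ P', b.Valid r α) ∧ listSize P' < listSize P) ∧
      ∀ v ∈ listLang P, ¬ List.SublistForall₂ r w v → ∃ P' ∈ Q, v ∈ listLang P' := by
  induction P generalizing w with
  | nil =>
    obtain rfl : w = [] := hw
    exact ⟨[], by simp, fun v _ h => (h .nil).elim⟩
  | cons a P ih =>
    obtain ⟨u, hu, w, hw, rfl⟩ := hw
    obtain ⟨ha, hP⟩ := List.forall_mem_cons.1 hP
    obtain ⟨Q₁, hQ₁, hl₁⟩ := exists_residual hα a ha u hu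
    obtain ⟨Q₂, hQ₂, hl₂⟩ := ih hP w hw
    refine ⟨Q₁.map (· ++ P) ++ Q₂.map (a :: ·), ?_, ?_⟩
    · intro R hR
      rcases List.mem_append.1 hR with hR | hR
      · obtain ⟨R, hR', rfl⟩ := List.mem_map.1 hR
        refine ⟨fun b hb => (List.mem_append.1 hb).elim ((hQ₁ R hR').1 b) (hP b), ?_⟩
        rw [listSize_append]
        exact natSum.lt_left _ (hQ₁ R hR').2
      · obtain ⟨R, hR', rfl⟩ := List.mem_map.1 hR
        exact ⟨List.forall_mem_cons.2 ⟨ha, (hQ₂ R hR').1⟩, natSum.lt_right _ (hQ₂ R hR').2⟩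
    · rintro _ ⟨u', hu', v', hv', rfl⟩ hn
      by_cases h : List.SublistForall₂ r u u'
      · obtain ⟨R, hR, hv⟩ := hl₂ v' hv' fun h' => hn (h.append h')
        exact ⟨a :: R, by simp [hR], u', hu', v', hv, rfl⟩
      · obtain ⟨R, hR, hv⟩ := hl₁ u' hu' h
        exact ⟨R ++ P, by simp [hR], append_mem_listLang hv hv'⟩

/-- Residuals are covered by finitely many languages of smaller size; the exponential in the bound
absorbs this finite union. -/
theorem residualBound_listLang (hα : ∀ γ ≤ α, γ < ω ^ γ) (P : List (WordAtom.{u} X))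
    (hP : ∀ a ∈ P, a.Valid r α) :
    ResidualBound (List.SublistForall₂ r) (ω ^ listSize P) (listLang P) := by
  generalize he : listSize P = e
  induction e using WellFoundedLT.induction generalizing P with | _ e ih =>
  refine ResidualBound.iff.2 fun w hw => ?_
  obtain ⟨Q, hQ, hl⟩ := exists_list_residual hα P hP w hw
  obtain ⟨γ, hγ, hb⟩ := ResidualBound.exists_biUnion_list (e := e) (S := listLang) Q
    fun R hR => ⟨_, (opow_lt_opow_iff_right one_lt_omega0).2 (he ▸ (hQ R hR).2),
      ih _ (he ▸ (hQ R hR).2) R (hQ R hR).1 rfl⟩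
  exact ⟨γ, hγ, hb.mono_set fun v hv => hl v hv.1 hv.2⟩

end WordAtom

/-- The bound for Higman's order. -/
theorem ResidualBound.sublistForall₂ {X : Type*} {r : X → X → Prop} {α : Ordinal.{u}}
    (h : ResidualBound r α Set.univ) (hα : ∀ γ ≤ α, γ < ω ^ γ) :
    ResidualBound (List.SublistForall₂ r) (ω ^ ω ^ α) Set.univ := by
  have key := WordAtom.residualBound_listLang hα [.star Set.univ α] (r := r) (by
    simpa using ⟨le_rfl, h⟩)
  simp only [WordAtom.listSize, WordAtom.size, natSum.zero_right] at key
  exact key.mono_set fun v _ => ⟨v, by simp [WordAtom.lang], [], rfl, by simp⟩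

/-! ### The lower bound for Higman's order: ordinals as values of words. -/

/-- The action of a letter labelled `a` on ordinals: successor for `a = 0`, and left
multiplication by `ω ^ ω ^ b`, made strictly inflationary, for `a = 1 + b`. -/
noncomputable def letterAct (a x : Ordinal.{u}) : Ordinal.{u} :=
  max (x + 1) (if a = 0 then 0 else ω ^ ω ^ (a - 1) * x)

theorem letterAct_zero (x : Ordinal.{u}) : letterAct 0 x = x + 1 := by
  simp [letterAct]

theorem letterAct_one_add (b x : Ordinal.{u}) :
    letterAct (1 + b) x = max (x + 1) (ω ^ ω ^ b * x) := by
  rw [letterAct, if_neg, Ordinal.add_sub_cancel]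
  simp

theorem le_letterAct (a x : Ordinal.{u}) : x ≤ letterAct a x :=
  le_self_add.trans (le_max_left _ _)

theorem letterAct_mono_right (a : Ordinal.{u}) {x y : Ordinal.{u}} (h : x ≤ y) :
    letterAct a x ≤ letterAct a y := by
  rw [letterAct, letterAct]
  split_ifs <;> gcongr

theorem letterAct_mono_left {a b : Ordinal.{u}} (x : Ordinal.{u}) (h : a ≤ b) :
    letterAct a x ≤ letterAct b x := by
  refine max_le_max le_rfl ?_
  split_ifs with ha hb hb
  · exact le_rfl
  · exact zero_le
  · exact absurd (nonpos_iff_eq_zero.1 (hb ▸ h)) ha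
  · have h1 : a - 1 ≤ b - 1 := Ordinal.sub_le.2 (h.trans (Ordinal.le_add_sub b 1))
    have h2 : (ω ^ ω ^ (a - 1) : Ordinal.{u}) ≤ ω ^ ω ^ (b - 1) :=
      opow_le_opow_right omega0_pos (opow_le_opow_right omega0_pos h1)
    gcongr

/-- The ordinal of a word of ordinals. -/
noncomputable def wordAct (l : List Ordinal.{u}) : Ordinal.{u} :=
  l.foldr letterAct 1

theorem one_le_wordAct (l : List Ordinal.{u}) : 1 ≤ wordAct l := by
  induction l with
  | nil => exact le_rfl
  | cons a l ih => exact ih.trans (le_letterAct _ _)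

theorem wordAct_mono {l m : List Ordinal.{u}} (h : List.SublistForall₂ (· ≤ ·) l m) :
    wordAct l ≤ wordAct m := by
  induction h with
  | nil => exact one_le_wordAct _
  | cons hab _ ih =>
    exact (letterAct_mono_right _ ih).trans (letterAct_mono_left _ hab)
  | cons_right _ ih => exact ih.trans (le_letterAct _ _)

/-- Split the leading term `ω ^ δ` off `γ`; the letter `1 + δ` supplies the factor `ω ^ ω ^ δ`, and
induction supplies the rest. -/
theorem exists_wordAct_opow_mul {α : Ordinal.{u}} (l : List Ordinal.{u}) (hl : ∀ a ∈ l, a < 1 + α)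
    (γ : Ordinal.{u}) (hγ : γ < ω ^ α) :
    ∃ m : List Ordinal.{u}, (∀ a ∈ m, a < 1 + α) ∧ wordAct m = ω ^ γ * wordAct l := by
  induction γ using WellFoundedLT.induction with | _ γ ih =>
  rcases eq_or_ne γ 0 with rfl | h0
  · exact ⟨l, hl, by simp⟩
  · obtain ⟨m, hm, he⟩ := ih (γ - ω ^ log ω γ) (sub_omega0_opow_log_lt h0)
      ((sub_omega0_opow_log_lt h0).trans hγ)
    have hγe : ω ^ γ * wordAct l = ω ^ ω ^ log ω γ * wordAct m := by
      rw [he, ← mul_assoc, ← opow_add, Ordinal.add_sub_cancel_of_le (opow_log_le_self ω h0)]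
    rw [hγe]
    -- If multiplication fixes the value, the letter would add `1` instead, so it is omitted.
    rcases (Ordinal.le_mul_right (wordAct m)
      (opow_pos (ω ^ log ω γ) omega0_pos)).eq_or_lt with heq | hlt
    · exact ⟨m, hm, heq⟩
    refine ⟨(1 + log ω γ) :: m, List.forall_mem_cons.2 ⟨?_, hm⟩, ?_⟩
    · gcongr
      exact (lt_opow_iff_log_lt one_lt_omega0 h0).1 hγ
    · change letterAct _ (wordAct m) = _
      rw [letterAct_one_add, max_eq_right (Order.add_one_le_of_lt hlt)]

/-- Every positive ordinal is a power of `ω` times a successor. -/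
theorem exists_eq_omega0_opow_mul_add_one (β : Ordinal.{u}) (hβ : β ≠ 0) :
    ∃ γ ρ : Ordinal.{u}, γ ≤ log ω β ∧ β = ω ^ γ * (ρ + 1) := by
  induction β using WellFoundedLT.induction with | _ β ih =>
  set δ := log ω β
  obtain ⟨c, hc⟩ := lt_omega0.1 (div_opow_log_lt β one_lt_omega0)
  have hc0 : c ≠ 0 := by
    rintro rfl
    exact (div_opow_log_pos ω hβ).ne' (by simpa using hc)
  have heq := Ordinal.div_add_mod β (ω ^ δ)
  rw [hc] at heq
  rcases eq_or_ne (β % ω ^ δ) 0 with h0 | h0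
  · obtain ⟨d, rfl⟩ := Nat.exists_eq_succ_of_ne_zero hc0
    exact ⟨δ, d, le_rfl, by simpa [h0] using heq.symm⟩
  · obtain ⟨γ, ρ, hγ, he⟩ := ih _ (mod_opow_log_lt_self ω hβ) h0
    have hγδ : γ ≤ δ := hγ.trans (log_mono_right ω (mod_opow_log_lt_self ω hβ).le)
    refine ⟨γ, ω ^ (δ - γ) * c + ρ, hγδ, ?_⟩
    rw [add_assoc, mul_add, ← he, ← mul_assoc, ← opow_add, Ordinal.add_sub_cancel_of_le hγδ, heq]

/-- Write `β = ω ^ γ * (ρ + 1)`: the letter `0` passes from `ρ` to `ρ + 1`, and the preceding lemma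
multiplies by `ω ^ γ`. The empty word has value `1`, which covers `ρ = 0`. -/
theorem exists_wordAct_eq {α : Ordinal.{u}} (β : Ordinal.{u}) (hβ : β ≠ 0)
    (hlt : β < ω ^ ω ^ α) :
    ∃ m : List Ordinal.{u}, (∀ a ∈ m, a < 1 + α) ∧ wordAct m = β := by
  induction β using WellFoundedLT.induction with | _ β ih =>
  obtain ⟨γ, ρ, hγ, he⟩ := exists_eq_omega0_opow_mul_add_one β hβ
  have hγα : γ < ω ^ α := hγ.trans_lt ((lt_opow_iff_log_lt one_lt_omega0 hβ).1 hlt)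
  have hρ : ρ < β := by
    rw [he]
    exact (Order.lt_add_one_iff.2 le_rfl).trans_le
      (Ordinal.le_mul_right _ (opow_pos γ omega0_pos))
  obtain ⟨l, hl, hw⟩ : ∃ l : List Ordinal.{u}, (∀ a ∈ l, a < 1 + α) ∧ wordAct l = ρ + 1 := by
    rcases eq_or_ne ρ 0 with rfl | h0
    · exact ⟨[], by simp, by simp [wordAct]⟩
    · obtain ⟨l, hl, hw⟩ := ih ρ hρ h0 (hρ.trans hlt)
      refine ⟨0 :: l, List.forall_mem_cons.2 ⟨zero_lt_one.trans_le le_self_add, hl⟩, ?_⟩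
      change letterAct 0 (wordAct l) = _
      rw [letterAct_zero, hw]
  obtain ⟨m, hm, hw'⟩ := exists_wordAct_opow_mul l hl γ hγα
  exact ⟨m, hm, by rw [hw', hw, he]⟩

/-! ### Inductive descriptions of gap embedding. -/

/-- Gap embedding of words where the letters skipped before the first matched letter also have
to be at least as large as that letter. -/
inductive AnchoredGap : List ℕ → List ℕ → Prop
  | nil {t : List ℕ} : AnchoredGap [] t
  | cons {a : ℕ} {s t : List ℕ} : AnchoredGap s t → AnchoredGap (a :: s) (a :: t)
  | skip {a b : ℕ} {s t : List ℕ} : a ≤ b → AnchoredGap (a :: s) t → AnchoredGap (a :: s) (b :: t)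

/-- Weak gap embedding of words, generated letter by letter. -/
inductive WeakGap : List ℕ → List ℕ → Prop
  | nil {t : List ℕ} : WeakGap [] t
  | cons {a : ℕ} {s t : List ℕ} : AnchoredGap s t → WeakGap (a :: s) (a :: t)
  | skip {b : ℕ} {s t : List ℕ} : WeakGap s t → WeakGap s (b :: t)

theorem AnchoredGap.weakGap {s t : List ℕ} (h : AnchoredGap s t) : WeakGap s t := by
  induction h with
  | nil => exact .nil
  | cons h _ => exact .cons h
  | skip _ _ ih => exact .skip ih

theorem WeakGap.sublist {s t : List ℕ} (h : WeakGap s t) : s.Sublist t := by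
  have anchored : ∀ {s t : List ℕ}, AnchoredGap s t → s.Sublist t := by
    intro s t h
    induction h with
    | nil => exact List.nil_sublist _
    | cons _ ih => exact ih.cons_cons _
    | skip _ _ ih => exact ih.cons _
  induction h with
  | nil => exact List.nil_sublist _
  | cons h => exact (anchored h).cons_cons _
  | skip _ ih => exact ih.cons _

/-- The positions of a weak gap embedding. -/
structure GapPositions (s t : List ℕ) (f : ℕ → ℕ) : Prop where
  lt_length : ∀ i < s.length, f i < t.length
  mono : ∀ i j, i < j → j < s.length → f i < f j
  eq : ∀ i < s.length, s.getD i 0 = t.getD (f i) 0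
  gap : ∀ i j, i + 1 < s.length → f i < j → j < f (i + 1) → s.getD (i + 1) 0 ≤ t.getD j 0

theorem GapPositions.tail_right {a b : ℕ} {s t : List ℕ} {f : ℕ → ℕ}
    (h : GapPositions (a :: s) (b :: t) f) (h0 : 0 < f 0) :
    GapPositions (a :: s) t (fun i => f i - 1) := by
  have hpos : ∀ i < (a :: s).length, 0 < f i := by
    intro i hi
    rcases Nat.eq_zero_or_pos i with rfl | hi'
    · exact h0
    · exact h0.trans (h.mono 0 i hi' hi)
  refine ⟨fun i hi => ?_, fun i j hij hj => ?_, fun i hi => ?_, fun i j hi h1 h2 => ?_⟩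
  · have := h.lt_length i hi
    have := hpos i hi
    simp only [List.length_cons] at *
    omega
  · have := h.mono i j hij hj
    have := hpos i (hij.trans hj)
    omega
  · have := h.eq i hi
    obtain ⟨m, hm⟩ := Nat.exists_eq_succ_of_ne_zero (hpos i hi).ne'
    simpa [hm] using this
  · have := h.gap i (j + 1) hi (by omega) (by omega)
    simpa using this

theorem GapPositions.tail {a b : ℕ} {s t : List ℕ} {f : ℕ → ℕ}
    (h : GapPositions (a :: s) (b :: t) f) (h0 : f 0 = 0) :
    a = b ∧ GapPositions s t (fun i => f (i + 1) - 1) ∧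
      ∀ j < f 1 - 1, 0 < s.length → s.getD 0 0 ≤ t.getD j 0 := by
  have hpos : ∀ i < s.length, 0 < f (i + 1) := fun i hi =>
    (Nat.zero_le _).trans_lt (h.mono 0 (i + 1) i.succ_pos (by simpa using hi))
  refine ⟨by simpa [h0] using h.eq 0 (by simp), ⟨fun i hi => ?_, fun i j hij hj => ?_,
    fun i hi => ?_, fun i j hi h1 h2 => ?_⟩, fun j hj hs => ?_⟩
  · have := h.lt_length (i + 1) (by simpa using hi)
    have := hpos i hi
    simp only [List.length_cons] at *
    omega
  · have := h.mono (i + 1) (j + 1) (by omega) (by simpa using hj)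
    have := hpos i (hij.trans hj)
    omega
  · have := h.eq (i + 1) (by simpa using hi)
    obtain ⟨m, hm⟩ := Nat.exists_eq_succ_of_ne_zero (hpos i hi).ne'
    simpa [hm] using this
  · have := h.gap (i + 1) (j + 1) (by simpa using hi) (by omega) (by omega)
    simpa using this
  · have := h.gap 0 (j + 1) (by simpa using hs) (by omega) (by simp; omega)
    simpa using this

theorem GapPositions.anchoredGap {s t : List ℕ} {f : ℕ → ℕ} (h : GapPositions s t f)
    (h' : ∀ j < f 0, 0 < s.length → s.getD 0 0 ≤ t.getD j 0) : AnchoredGap s t := by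
  induction t generalizing s f with
  | nil =>
    cases s with
    | nil => exact .nil
    | cons a s => exact absurd (h.lt_length 0 (by simp)) (by simp)
  | cons b t ih =>
    cases s with
    | nil => exact .nil
    | cons a s =>
      rcases Nat.eq_zero_or_pos (f 0) with h0 | h0
      · obtain ⟨rfl, ht, hg⟩ := h.tail h0
        exact .cons (ih ht hg)
      · refine .skip (by simpa using h' 0 h0) (ih (h.tail_right h0) fun j hj hs => ?_)
        simpa using h' (j + 1) (by omega) hs

theorem GapPositions.weakGap {s t : List ℕ} {f : ℕ → ℕ} (h : GapPositions s t f) :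
    WeakGap s t := by
  induction t generalizing s f with
  | nil =>
    cases s with
    | nil => exact .nil
    | cons a s => exact absurd (h.lt_length 0 (by simp)) (by simp)
  | cons b t ih =>
    cases s with
    | nil => exact .nil
    | cons a s =>
      rcases Nat.eq_zero_or_pos (f 0) with h0 | h0
      · obtain ⟨rfl, ht, hg⟩ := h.tail h0
        exact .cons (ht.anchoredGap hg)
      · exact .skip (ih (h.tail_right h0))

theorem GapPositions.skip {b : ℕ} {s t : List ℕ} {f : ℕ → ℕ} (h : GapPositions s t f) :
    GapPositions s (b :: t) (fun i => f i + 1) := by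
  refine ⟨fun i hi => by simpa using h.lt_length i hi, fun i j hij hj => by
    simpa using h.mono i j hij hj, fun i hi => by simpa using h.eq i hi, fun i j hi h1 h2 => ?_⟩
  obtain ⟨j, rfl⟩ := Nat.exists_eq_succ_of_ne_zero (Nat.ne_zero_of_lt h1)
  simpa using h.gap i j hi (by omega) (by omega)

theorem GapPositions.cons {a : ℕ} {s t : List ℕ} {f : ℕ → ℕ} (h : GapPositions s t f)
    (h' : ∀ j < f 0, 0 < s.length → s.getD 0 0 ≤ t.getD j 0) :
    GapPositions (a :: s) (a :: t) (fun i => i.casesOn 0 (fun k => f k + 1)) := by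
  refine ⟨fun i hi => ?_, fun i j hij hj => ?_, fun i hi => ?_, fun i j hi h1 h2 => ?_⟩
  · cases i with
    | zero => simp
    | succ i => simpa using h.lt_length i (by simpa using hi)
  · obtain ⟨j, rfl⟩ := Nat.exists_eq_succ_of_ne_zero (Nat.ne_zero_of_lt hij)
    cases i with
    | zero => simp
    | succ i => simpa using h.mono i j (by omega) (by simpa using hj)
  · cases i with
    | zero => simp
    | succ i => simpa using h.eq i (by simpa using hi)
  · obtain ⟨j, rfl⟩ := Nat.exists_eq_succ_of_ne_zero (Nat.ne_zero_of_lt h1)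
    cases i with
    | zero => simpa using h' j (by simpa using h2) (by simpa using hi)
    | succ i => simpa using h.gap i j (by simpa using hi) (by simpa using h1) (by simpa using h2)

theorem AnchoredGap.exists_gapPositions {s t : List ℕ} (h : AnchoredGap s t) :
    ∃ f, GapPositions s t f ∧ ∀ j < f 0, 0 < s.length → s.getD 0 0 ≤ t.getD j 0 := by
  induction h with
  | nil => exact ⟨id, ⟨by simp, by simp, by simp, by simp⟩, by simp⟩
  | cons _ ih =>
    obtain ⟨f, hf, hg⟩ := ih
    exact ⟨_, hf.cons hg, by simp⟩
  | skip hab _ ih =>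
    obtain ⟨f, hf, hg⟩ := ih
    refine ⟨_, hf.skip, fun j hj hs => ?_⟩
    cases j with
    | zero => simpa using hab
    | succ j => simpa using hg j (by omega) hs

theorem WeakGap.exists_gapPositions {s t : List ℕ} (h : WeakGap s t) :
    ∃ f, GapPositions s t f := by
  induction h with
  | nil => exact ⟨id, by simp, by simp, by simp, by simp⟩
  | cons h =>
    obtain ⟨f, hf, hg⟩ := h.exists_gapPositions
    exact ⟨_, hf.cons hg⟩
  | skip _ ih =>
    obtain ⟨f, hf⟩ := ih
    exact ⟨_, hf.skip⟩

theorem getD_map_val {n : ℕ} (s : List (Fin n)) (i : ℕ) (hi : i < s.length) :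
    (s.map Fin.val).getD i 0 = (s.get ⟨i, hi⟩ : ℕ) := by
  simp [List.getD_eq_getElem?_getD, hi]

theorem weakGapEmb_iff_weakGap {n : ℕ} {s t : List (Fin n)} :
    WeakGapEmb s t ↔ WeakGap (s.map Fin.val) (t.map Fin.val) := by
  constructor
  · rintro ⟨f, hf, he, hg⟩
    -- The default `0` is harmless: every condition concerns positions inside `s` only.
    refine GapPositions.weakGap (f := fun i => if h : i < s.length then f ⟨i, h⟩ else 0)
      ⟨fun i hi => ?_, fun i j hij hj => ?_, fun i hi => ?_, fun i j hi h1 h2 => ?_⟩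
    · rw [List.length_map] at hi ⊢
      simp [hi]
    · rw [List.length_map] at hj
      simp only [hij.trans hj, hj, dif_pos]
      exact hf hij
    · rw [List.length_map] at hi
      simp only [hi, dif_pos]
      rw [getD_map_val s i hi, getD_map_val t _ (f ⟨i, hi⟩).2, he]
    · rw [List.length_map] at hi
      simp only [hi, (Nat.lt_succ_self i).trans hi, dif_pos] at h1 h2
      have hj := h2.trans (f ⟨i + 1, hi⟩).2
      rw [getD_map_val s _ hi, getD_map_val t j hj]
      exact hg i hi ⟨j, hj⟩ h1 h2
  · intro h
    obtain ⟨f, h1, h2, h3, h4⟩ := h.exists_gapPositions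
    simp only [List.length_map] at h1 h2 h3 h4
    refine ⟨fun i => ⟨f i, h1 i i.2⟩, fun i j hij => h2 i j hij j.2, fun i => ?_,
      fun i hi j hj1 hj2 => ?_⟩
    · have := h3 i i.2
      rw [getD_map_val s i i.2, getD_map_val t _ (h1 i i.2)] at this
      exact Fin.ext this
    · have := h4 i j hi hj1 hj2
      rw [getD_map_val s _ hi, getD_map_val t _ j.2] at this
      exact this

/-! ### Iterated sequences and block decompositions of words. -/

/-- Iterated finite sequences over the natural numbers. -/
def HigSeq : ℕ → Type
  | 0 => ℕ
  | k + 1 => List (HigSeq k)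

/-- The iterated Higman order. -/
def HigSeq.Le : ∀ k, HigSeq k → HigSeq k → Prop
  | 0 => fun a b : ℕ => a ≤ b
  | k + 1 => List.SublistForall₂ (HigSeq.Le k)

/-- Concatenation of blocks, each preceded by the letter `d`. -/
def blockJoin (d : ℕ) (ts : List (List ℕ)) : List ℕ :=
  ts.flatMap (d :: ·)

theorem blockJoin_cons (d : ℕ) (t : List ℕ) (ts : List (List ℕ)) :
    blockJoin d (t :: ts) = d :: (t ++ blockJoin d ts) := by
  simp [blockJoin]

theorem head?_blockJoin (d : ℕ) (ts : List (List ℕ)) : ∀ x ∈ (blockJoin d ts).head?, x = d := by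
  cases ts <;> simp [blockJoin]

theorem List.SublistForall₂.imp_of_mem {X Y : Type*} {R S : X → Y → Prop} {l : List X}
    {m : List Y} (h : List.SublistForall₂ R l m) (hRS : ∀ a ∈ l, ∀ b ∈ m, R a b → S a b) :
    List.SublistForall₂ S l m := by
  induction h with
  | nil => exact .nil
  | cons hab _ ih =>
    exact .cons (hRS _ List.mem_cons_self _ List.mem_cons_self hab)
      (ih fun a ha b hb => hRS a (List.mem_cons_of_mem _ ha) b (List.mem_cons_of_mem _ hb))
  | cons_right _ ih =>
    exact .cons_right (ih fun a ha b hb => hRS a ha b (List.mem_cons_of_mem _ hb))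

theorem AnchoredGap.skip_append {s t u : List ℕ} (hs : ∀ x ∈ s.head?, ∀ y ∈ u, x ≤ y)
    (h : AnchoredGap s t) : AnchoredGap s (u ++ t) := by
  induction u with
  | nil => exact h
  | cons b u ih =>
    cases s with
    | nil => exact .nil
    | cons a s =>
      simp only [List.head?_cons, Option.mem_def, Option.some.injEq, forall_eq', List.mem_cons,
        forall_eq_or_imp] at hs ih
      exact .skip hs.1 (ih hs.2)

theorem AnchoredGap.append {s t s' t' : List ℕ} (h : AnchoredGap s t)
    (hs : ∀ x ∈ s'.head?, ∀ y ∈ t, x ≤ y) (h' : AnchoredGap s' t') :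
    AnchoredGap (s ++ s') (t ++ t') := by
  induction h with
  | nil => exact h'.skip_append hs
  | cons _ ih => exact .cons (ih fun x hx y hy => hs x hx y (List.mem_cons_of_mem _ hy))
  | skip hab _ ih => exact .skip hab (ih fun x hx y hy => hs x hx y (List.mem_cons_of_mem _ hy))

theorem WeakGap.skip_append {s t : List ℕ} (u : List ℕ) (h : WeakGap s t) :
    WeakGap s (u ++ t) := by
  induction u with
  | nil => exact h
  | cons b u ih => exact .skip ih

/-- The unused end of `t` falls into the gap before the first letter of `s'`, which explains the
condition on that letter and why the second embedding is anchored. -/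
theorem WeakGap.append {s t s' t' : List ℕ} (h : WeakGap s t)
    (hs : ∀ x ∈ s'.head?, ∀ y ∈ t, x ≤ y) (h' : AnchoredGap s' t') :
    WeakGap (s ++ s') (t ++ t') := by
  induction h with
  | nil => exact h'.weakGap.skip_append _
  | cons h =>
    exact .cons (h.append (fun x hx y hy => hs x hx y (List.mem_cons_of_mem _ hy)) h')
  | skip _ ih => exact .skip (ih fun x hx y hy => hs x hx y (List.mem_cons_of_mem _ hy))

theorem WeakGap.anchoredGap {s t : List ℕ} (h : WeakGap s t)
    (hs : ∀ x ∈ s.head?, ∀ y ∈ t, x ≤ y) : AnchoredGap s t := by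
  induction h with
  | nil => exact .nil
  | cons h => exact .cons h
  | @skip b s t _ ih =>
    cases s with
    | nil => exact .nil
    | cons a s =>
      simp only [List.head?_cons, Option.mem_def, Option.some.injEq, forall_eq', List.mem_cons,
        forall_eq_or_imp] at hs ih
      exact .skip hs.1 (ih hs.2)

section Blocks

variable {d : ℕ}

/-- A block begins with at most `d + 1`, a lower bound for the letters of target blocks, so weak
embeddings of blocks are automatically anchored. Whole target blocks may be skipped because the next
letter to match is `d`. -/
theorem anchoredGap_blockJoin {ts ts' : List (List ℕ)}
    (h : List.SublistForall₂ WeakGap ts ts') (hts : ∀ t ∈ ts, ∀ x ∈ t.head?, x ≤ d + 1)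
    (hts' : ∀ t ∈ ts', ∀ x ∈ t, d + 1 ≤ x) :
    AnchoredGap (blockJoin d ts) (blockJoin d ts') := by
  induction h with
  | nil => exact .nil
  | @cons t t' ts ts' htt _ ih =>
    rw [List.forall_mem_cons] at hts hts'
    rw [blockJoin_cons, blockJoin_cons]
    refine .cons ((htt.anchoredGap ?_).append ?_ (ih hts.2 hts'.2))
    · exact fun x hx y hy => (hts.1 x hx).trans (hts'.1 y hy)
    · intro x hx y hy
      rw [head?_blockJoin d ts x hx]
      exact (Nat.le_succ d).trans (hts'.1 y hy)
  | @cons_right t' ts ts' _ ih =>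
    rw [List.forall_mem_cons] at hts'
    rw [blockJoin_cons]
    refine (ih hts hts'.2).skip_append (u := d :: t') fun x hx y hy => ?_
    rw [head?_blockJoin d ts x hx]
    rcases List.mem_cons.1 hy with rfl | hy
    exacts [le_rfl, (Nat.le_succ d).trans (hts'.1 y hy)]

theorem weakGap_append_blockJoin {t₀ t₀' : List ℕ} {ts ts' : List (List ℕ)}
    (h : List.SublistForall₂ WeakGap (t₀ :: ts) (t₀' :: ts'))
    (hts : ∀ t ∈ ts, ∀ x ∈ t.head?, x ≤ d + 1) (ht₀' : ∀ x ∈ t₀', d + 1 ≤ x)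
    (hts' : ∀ t ∈ ts', ∀ x ∈ t, d + 1 ≤ x) :
    WeakGap (t₀ ++ blockJoin d ts) (t₀' ++ blockJoin d ts') := by
  induction ts' generalizing t₀' with
  | nil =>
    cases h with
    | cons h0 h =>
      exact h0.append (fun x hx y hy => by
        rw [head?_blockJoin d ts x hx]
        exact (Nat.le_succ d).trans (ht₀' y hy)) (anchoredGap_blockJoin h hts hts')
    | cons_right h => cases h
  | cons t' ts' ih =>
    cases h with
    | cons h0 h =>
      exact h0.append (fun x hx y hy => by
        rw [head?_blockJoin d ts x hx]
        exact (Nat.le_succ d).trans (ht₀' y hy)) (anchoredGap_blockJoin h hts hts')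
    | cons_right h =>
      rw [List.forall_mem_cons] at hts'
      rw [blockJoin_cons]
      -- Nothing has been matched yet, so `t₀'` and the separator after it can be skipped without
      -- any condition.
      exact (WeakGap.skip (ih h hts'.1 hts'.2)).skip_append _

/-- Letters above `d` can neither match nor jump over the `d` that opens `t'`, so `s` must fit into
`t`; the `d` that opens `s'` finds no match in `t`. -/
theorem AnchoredGap.split {s s' t t' : List ℕ} (h : AnchoredGap (s ++ s') (t ++ t'))
    (hs : ∀ x ∈ s, d < x) (ht : ∀ x ∈ t, d < x) (hs' : ∀ x ∈ s'.head?, x = d)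
    (ht' : ∀ x ∈ t'.head?, x = d) : AnchoredGap s t ∧ WeakGap s' t' := by
  induction t generalizing s with
  | nil =>
    cases s with
    | nil => exact ⟨.nil, h.weakGap⟩
    | cons a s =>
      have ha := hs a List.mem_cons_self
      cases t' with
      | nil => cases h
      | cons c t' =>
        obtain rfl : c = d := ht' c rfl
        rcases h with _ | _ | h
        · exact absurd ha (lt_irrefl _)
        · exact absurd ha h.not_gt
  | cons b t ih =>
    rw [List.forall_mem_cons] at ht
    cases s with
    | nil =>
      refine ⟨.nil, ?_⟩
      cases s' with
      | nil => exact .nil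
      | cons c s' =>
        obtain rfl : c = d := hs' c rfl
        rcases h with _ | _ | ⟨_, h⟩
        · exact absurd ht.1 (lt_irrefl _)
        · exact (ih (s := []) h hs ht.2).2
    | cons a s =>
      rcases h with _ | h | ⟨hab, h⟩
      · obtain ⟨h1, h2⟩ := ih h (List.forall_mem_cons.1 hs).2 ht.2
        exact ⟨.cons h1, h2⟩
      · obtain ⟨h1, h2⟩ := ih (s := a :: s) h hs ht.2
        exact ⟨.skip hab h1, h2⟩

theorem WeakGap.of_append {s t u : List ℕ} (h : WeakGap (d :: s) (u ++ t))
    (hu : ∀ x ∈ u, d < x) : WeakGap (d :: s) t := by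
  induction u with
  | nil => exact h
  | cons b u ih =>
    rw [List.forall_mem_cons] at hu
    rcases h with _ | _ | h
    · exact absurd hu.1 (lt_irrefl _)
    · exact ih h hu.2

theorem WeakGap.of_blockJoin {ts ts' : List (List ℕ)}
    (h : WeakGap (blockJoin d ts) (blockJoin d ts')) (hts : ∀ t ∈ ts, ∀ x ∈ t, d < x)
    (hts' : ∀ t ∈ ts', ∀ x ∈ t, d < x) : List.SublistForall₂ WeakGap ts ts' := by
  induction ts' generalizing ts with
  | nil =>
    cases ts with
    | nil => exact .nil
    | cons t ts =>
      rw [blockJoin_cons] at h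
      cases h
  | cons t' ts' ih =>
    cases ts with
    | nil => exact .nil
    | cons t ts =>
      have hts₀ := List.forall_mem_cons.1 hts
      rw [List.forall_mem_cons] at hts'
      rw [blockJoin_cons, blockJoin_cons] at h
      rcases h with _ | h | h
      · obtain ⟨h1, h2⟩ := h.split hts₀.1 hts'.1 (head?_blockJoin d ts) (head?_blockJoin d ts')
        exact .cons h1.weakGap (ih h2 hts₀.2 hts'.2)
      · refine .cons_right (ih ?_ hts hts'.2)
        rw [blockJoin_cons]
        exact h.of_append hts'.1

end Blocks

namespace HigSeq

/-- The word with letters in `{d, …, d + k}` that encodes an iterated sequence. -/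
def enc : ∀ k : ℕ, ℕ → HigSeq k → List ℕ
  | 0, d => fun m : ℕ => List.replicate m d
  | k + 1, d => fun l : List (HigSeq k) => blockJoin d (l.map (enc k (d + 1)))

theorem mem_enc {k d : ℕ} {t : HigSeq k} {x : ℕ} (h : x ∈ enc k d t) : d ≤ x ∧ x ≤ d + k := by
  induction k generalizing d with
  | zero =>
    obtain rfl : x = d := List.eq_of_mem_replicate h
    exact ⟨le_rfl, le_rfl⟩
  | succ k ih =>
    change List (HigSeq k) at t
    change x ∈ blockJoin d (t.map (enc k (d + 1))) at h
    simp only [blockJoin, List.mem_flatMap, List.mem_map, List.mem_cons] at h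
    obtain ⟨_, ⟨u, -, rfl⟩, rfl | h⟩ := h
    · omega
    · have := ih h
      omega

theorem head?_enc (k d : ℕ) (t : HigSeq k) : ∀ x ∈ (enc k d t).head?, x = d := by
  cases k with
  | zero =>
    intro x hx
    exact List.eq_of_mem_replicate (List.mem_of_mem_head? hx)
  | succ k => exact head?_blockJoin d _

theorem isChain_enc (k d : ℕ) (t : HigSeq k) :
    (enc k d t).IsChain fun a b => b ≤ a + 1 := by
  induction k generalizing d with
  | zero => exact List.isChain_replicate_of_rel t (Nat.le_succ d)
  | succ k ih =>
    change List (HigSeq k) at t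
    change List.IsChain _ (blockJoin d (t.map (enc k (d + 1))))
    induction t with
    | nil => simp [blockJoin]
    | cons u t iht =>
      rw [List.map_cons, blockJoin_cons, List.isChain_cons, List.isChain_append]
      refine ⟨fun y hy => ?_, ih _ u, iht, fun x hx y hy => ?_⟩
      · rw [List.head?_append] at hy
        rcases Option.or_eq_some_iff.1 hy with h | h
        · exact (head?_enc k (d + 1) u y h).le
        · exact (head?_blockJoin d _ y h.2).le.trans (Nat.le_succ d)
      · have h1 := (mem_enc (List.mem_of_getLast? hx)).1
        rw [head?_blockJoin d _ y hy]
        omega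

theorem le_of_weakGap_enc {k d : ℕ} {a b : HigSeq k} (h : WeakGap (enc k d a) (enc k d b)) :
    Le k a b := by
  induction k generalizing d with
  | zero =>
    change ℕ at a b
    have h' : (List.replicate a d).length ≤ (List.replicate b d).length := h.sublist.length_le
    rw [List.length_replicate, List.length_replicate] at h'
    exact h'
  | succ k ih =>
    change List (HigSeq k) at a b
    have := WeakGap.of_blockJoin h (by
      simp only [List.mem_map]
      rintro _ ⟨u, -, rfl⟩ x hx
      exact (mem_enc hx).1) (by
      simp only [List.mem_map]
      rintro _ ⟨u, -, rfl⟩ x hx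
      exact (mem_enc hx).1)
    rw [List.sublistForall₂_map_left_iff, List.sublistForall₂_map_right_iff] at this
    exact this.imp_of_mem fun u _ v _ huv => ih huv

/-- The restricted words with letters in `{d, …, d + k}`. -/
def Valid (d k : ℕ) (s : List ℕ) : Prop :=
  (s.IsChain fun a b => b ≤ a + 1) ∧ ∀ x ∈ s, d ≤ x ∧ x ≤ d + k

/-- Cut at every `d`. The rise condition makes a block following `d` start with at most `d + 1`; the
part before the first `d` has no such constraint and is kept separate. -/
theorem Valid.exists_blocks {d k : ℕ} {s : List ℕ} (h : Valid d (k + 1) s) :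
    ∃ t₀ ts, s = t₀ ++ blockJoin d ts ∧ Valid (d + 1) k t₀ ∧
      ∀ t ∈ ts, Valid (d + 1) k t ∧ ∀ x ∈ t.head?, x ≤ d + 1 := by
  induction s with
  | nil => exact ⟨[], [], rfl, ⟨.nil, by simp⟩, by simp⟩
  | cons a s ih =>
    have hm := List.forall_mem_cons.1 h.2
    have hc := List.isChain_cons.1 h.1
    obtain ⟨t₀, ts, rfl, h₀, hts⟩ := ih ⟨hc.2, hm.2⟩
    rcases eq_or_ne a d with rfl | had
    · refine ⟨[], t₀ :: ts, by rw [blockJoin_cons, List.nil_append], ⟨.nil, by simp⟩,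
        List.forall_mem_cons.2 ⟨⟨h₀, fun x hx => hc.1 x ?_⟩, hts⟩⟩
      rw [List.head?_append, Option.mem_def.1 hx]
      rfl
    · refine ⟨a :: t₀, ts, rfl, ⟨?_, List.forall_mem_cons.2 ⟨by omega, h₀.2⟩⟩, hts⟩
      have := h.1
      rw [← List.cons_append] at this
      exact (List.isChain_append.1 this).1

/-- The initial block becomes the first list entry. No inverse to `enc` is sought: only reflection
of the order is needed to pull back the upper bound. -/
theorem exists_dec (k d : ℕ) : ∃ dec : List ℕ → HigSeq k, ∀ s s', Valid d k s → Valid d k s' →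
    Le k (dec s) (dec s') → WeakGap s s' := by
  induction k generalizing d with
  | zero =>
    refine ⟨List.length, fun s s' hs hs' h => ?_⟩
    change s.length ≤ s'.length at h
    have key : ∀ m m' : ℕ, m ≤ m' →
        AnchoredGap (List.replicate m d) (List.replicate m' d) := by
      intro m m' h
      induction m' generalizing m with
      | zero =>
        obtain rfl := Nat.le_zero.1 h
        exact .nil
      | succ m' ih =>
        cases m with
        | zero => exact .nil
        | succ m => exact .cons (ih m (by omega))
    have heq : ∀ s, Valid d 0 s → s = List.replicate s.length d := fun s hs =>
      List.eq_replicate_iff.2 ⟨rfl, fun x hx => le_antisymm (hs.2 x hx).2 (hs.2 x hx).1⟩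
    rw [heq s hs, heq s' hs']
    exact (key _ _ h).weakGap
  | succ k ih =>
    obtain ⟨dec, hdec⟩ := ih (d + 1)
    choose! t₀ ts heq h₀ hts using fun s (hs : Valid d (k + 1) s) => hs.exists_blocks
    refine ⟨fun s => (t₀ s :: ts s).map dec, fun s s' hs hs' h => ?_⟩
    change List.SublistForall₂ (Le k) ((t₀ s :: ts s).map dec) ((t₀ s' :: ts s').map dec) at h
    rw [List.sublistForall₂_map_left_iff, List.sublistForall₂_map_right_iff] at h
    have valid : ∀ s, Valid d (k + 1) s → ∀ t ∈ t₀ s :: ts s, Valid (d + 1) k t := fun s hs =>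
      List.forall_mem_cons.2 ⟨h₀ s hs, fun t ht => (hts s hs t ht).1⟩
    rw [heq s hs, heq s' hs']
    exact weakGap_append_blockJoin
      (h.imp_of_mem fun a ha b hb => hdec a b (valid s hs a ha) (valid s' hs' b hb))
      (fun t ht => (hts s hs t ht).2) (fun x hx => ((h₀ s' hs').2 x hx).1)
      fun t ht x hx => ((hts s' hs' t ht).1.2 x hx).1

end HigSeq

/-! ### Towers, and both bounds for iterated sequences. -/

theorem omegaTower_zero : omegaTower.{u} 0 = 1 := rfl

theorem omegaTower_succ (m : ℕ) : omegaTower.{u} (m + 1) = ω ^ omegaTower.{u} m := rfl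

theorem lt_omega0_opow_of_le_omegaTower {m : ℕ} {γ : Ordinal.{u}} (h : γ ≤ omegaTower m) :
    γ < ω ^ γ := by
  induction m generalizing γ with
  | zero =>
    rw [omegaTower_zero] at h
    rcases Order.le_one_iff.1 h with rfl | rfl
    · simp
    · simp
  | succ m ih =>
    by_contra! hγ
    have h1 : γ ≤ omegaTower m := by
      rw [omegaTower_succ] at h
      exact (opow_le_opow_iff_right one_lt_omega0).1 (hγ.trans h)
    exact (ih h1).not_ge hγ

theorem omega0_le_omegaTower_succ (m : ℕ) : ω ≤ omegaTower.{u} (m + 1) := by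
  rw [omegaTower_succ]
  refine left_le_opow ω ?_
  cases m with
  | zero => simp [omegaTower_zero]
  | succ m => exact opow_pos _ omega0_pos

namespace HigSeq

theorem residualBound (k : ℕ) :
    ResidualBound (Le k) (omegaTower.{u} (2 * k + 1)) Set.univ := by
  induction k with
  | zero =>
    have key : ∀ n : ℕ, ResidualBound (Le 0) (n : Ordinal.{u}) {y : ℕ | y < n} := by
      intro n
      induction n using Nat.strong_induction_on with | _ n ih =>
      refine ResidualBound.iff.2 fun x hx => ⟨_, Nat.cast_lt.2 hx, (ih x hx).mono_set ?_⟩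
      exact fun y hy => not_le.1 hy.2
    refine ResidualBound.iff.2 fun (x : ℕ) _ => ⟨x, ?_, (key x).mono_set ?_⟩
    · rw [omegaTower_succ, mul_zero, omegaTower_zero, opow_one]
      exact natCast_lt_omega0 x
    · exact fun y hy => not_le.1 hy.2
  | succ k ih =>
    exact ih.sublistForall₂ fun γ hγ => lt_omega0_opow_of_le_omegaTower hγ

/-- A monotone ordinal value of iterated sequences. -/
noncomputable def value : ∀ k, HigSeq k → Ordinal.{u}
  | 0 => fun m : ℕ => (m : Ordinal.{u})
  | k + 1 => fun l : List (HigSeq k) => wordAct (l.map (value k)) - 1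

theorem value_mono {k : ℕ} {a b : HigSeq k} (h : Le k a b) :
    value.{u} k a ≤ value.{u} k b := by
  induction k with
  | zero => exact Nat.cast_le.2 h
  | succ k ih =>
    change List (HigSeq k) at a b
    change wordAct (a.map (value k)) - 1 ≤ wordAct (b.map (value k)) - 1
    refine Ordinal.sub_le.2 (le_trans (wordAct_mono ?_) (Ordinal.le_add_sub _ 1))
    rw [List.sublistForall₂_map_left_iff, List.sublistForall₂_map_right_iff]
    exact List.SublistForall₂.imp_of_mem h fun u _ v _ huv => ih huv

theorem exists_value_eq {k : ℕ} {γ : Ordinal.{u}} (h : γ < omegaTower (2 * k + 1)) :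
    ∃ t : HigSeq k, value k t = γ := by
  induction k generalizing γ with
  | zero =>
    rw [omegaTower_succ, mul_zero, omegaTower_zero, opow_one] at h
    obtain ⟨n, rfl⟩ := lt_omega0.1 h
    exact ⟨(n : ℕ), rfl⟩
  | succ k ih =>
    -- Word values start at `1`, hence the shift to `1 + γ`, undone by the `- 1` in `value`. The
    -- tower is additively principal, so the shift stays below it.
    obtain ⟨m, hm, he⟩ := exists_wordAct_eq (α := omegaTower (2 * k + 1)) (1 + γ) (by simp)
      (isPrincipal_add_omega0_opow _
        (one_lt_omega0.trans_le (omega0_le_omegaTower_succ (2 * k + 2))) h)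
    rw [one_add_of_omega0_le (omega0_le_omegaTower_succ _)] at hm
    have hl : ∃ l : List (HigSeq k), l.map (value k) = m := by
      clear he
      induction m with
      | nil => exact ⟨[], rfl⟩
      | cons a m ihm =>
        rw [List.forall_mem_cons] at hm
        obtain ⟨l, rfl⟩ := ihm hm.2
        obtain ⟨t, rfl⟩ := ih hm.1
        exact ⟨t :: l, rfl⟩
    obtain ⟨l, rfl⟩ := hl
    refine ⟨l, ?_⟩
    change wordAct (l.map (value k)) - 1 = γ
    rw [he, Ordinal.add_sub_cancel]

end HigSeq

/-! ### Long linear extensions from monotone maps. -/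

/-- A monotone map whose values include all ordinals below `β` forces the maximal order type to
be at least `β`. -/
theorem le_maxOrderType {X : Type u} [PartialOrder X] [WellQuasiOrderedLE X] {β : Ordinal.{u}}
    (h : X → Ordinal.{u}) (hm : Monotone h) (hs : ∀ γ < β, ∃ x, h x = γ) :
    β ≤ maxOrderType X := by
  have : WellQuasiOrderedLE (LinearExtension X) :=
    ⟨fun f => by
      let g : ℕ → X := f
      obtain ⟨m, n, hmn, hle⟩ := wellQuasiOrdered_le g
      exact ⟨m, n, hmn, (toLinearExtension (α := X)).monotone hle⟩⟩
  -- Compare by `h` first and break ties by a linear extension, which is well-founded because `X` is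
  -- well-quasi-ordered.
  let e : X ↪ Ordinal.{u} × LinearExtension X :=
    ⟨fun x => (h x, toLinearExtension x), fun x y hxy => congrArg Prod.snd hxy⟩
  let s : Ordinal.{u} × LinearExtension X → Ordinal.{u} × LinearExtension X → Prop :=
    Prod.Lex (· < ·) (· < ·)
  have hw : IsWellOrder X (e ⁻¹'o s) := (RelEmbedding.preimage e s).isWellOrder
  have key : ∀ γ : Ordinal.{u}, ∀ x, h x = γ → γ < β → γ ≤ typein (e ⁻¹'o s) x := by
    intro γ
    induction γ using WellFoundedLT.induction with | _ γ ih =>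
    intro x hx hγ
    refine le_of_forall_lt fun o ho => ?_
    obtain ⟨y, hy⟩ := hs o (ho.trans hγ)
    refine (ih o ho y hy (ho.trans hγ)).trans_lt ((typein_lt_typein _).2 ?_)
    exact Prod.Lex.left _ _ (by rwa [hx, hy])
  refine le_trans (le_of_forall_lt fun γ hγ => ?_)
    (le_csSup (bddAbove_extensionTypes X) ⟨e ⁻¹'o s, hw, fun x y hxy => ?_, rfl⟩)
  · obtain ⟨x, hx⟩ := hs γ hγ
    exact (key γ x hx hγ).trans_lt (typein_lt_type _ x)
  · rcases hxy.eq_or_lt with rfl | hlt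
    · exact Or.inl rfl
    · refine Or.inr (Prod.lex_def.2 ?_)
      rcases (hm hxy).lt_or_eq with h1 | h1
      · exact Or.inl h1
      · refine Or.inr ⟨h1, lt_of_le_of_ne (toLinearExtension.monotone hxy) fun h2 => ?_⟩
        exact hlt.ne h2

/-! ### Transfer to restricted sequences. -/

namespace RestrictedSeq

theorem le_iff_weakGap {n : ℕ} {s t : RestrictedSeq n} :
    s ≤ t ↔ WeakGap (s.toList.map Fin.val) (t.toList.map Fin.val) :=
  weakGapEmb_iff_weakGap

theorem valid {k : ℕ} (s : RestrictedSeq (k + 1)) :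
    HigSeq.Valid 0 k (s.toList.map Fin.val) := by
  refine ⟨List.isChain_iff_getElem.2 fun i hi => ?_, fun x hx => ?_⟩
  · have := s.rise_le_one i (by simpa using hi)
    simpa using this
  · obtain ⟨a, -, rfl⟩ := List.mem_map.1 hx
    exact ⟨Nat.zero_le _, by omega⟩

theorem exists_of_valid {k : ℕ} {l : List ℕ} (h : HigSeq.Valid 0 k l) :
    ∃ s : RestrictedSeq (k + 1), s.toList.map Fin.val = l := by
  have hl : ∃ m : List (Fin (k + 1)), m.map Fin.val = l :=
    ⟨l.pmap Fin.mk fun x hx => by have := (h.2 x hx).2; omega, by simp [List.map_pmap]⟩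
  obtain ⟨m, rfl⟩ := hl
  refine ⟨⟨m, fun i hi => ?_⟩, rfl⟩
  have := List.isChain_iff_getElem.1 h.1 i (by simpa using hi)
  simpa using this

theorem residualBound (k : ℕ) :
    ResidualBound (X := RestrictedSeq (k + 1)) (· ≤ ·) (omegaTower.{u} (2 * k + 1))
      Set.univ := by
  obtain ⟨dec, hdec⟩ := HigSeq.exists_dec k 0
  exact (HigSeq.residualBound k).comap (fun s => dec (s.toList.map Fin.val))
    (Set.mapsTo_univ _ _) fun s _ t _ h => le_iff_weakGap.2 (hdec _ _ s.valid t.valid h)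

/-- The supremum of the values of all sequences encoded below `s` is monotone in `s`. At `enc t` it
equals the value of `t`, since `enc` reflects the order and `HigSeq.value` is monotone. -/
theorem exists_monotone (k : ℕ) : ∃ h : RestrictedSeq (k + 1) → Ordinal.{0}, Monotone h ∧
    ∀ γ < omegaTower (2 * k + 1), ∃ x, h x = γ := by
  choose enc henc using fun t : HigSeq k => exists_of_valid (k := k)
    ⟨HigSeq.isChain_enc k 0 t, fun x hx => HigSeq.mem_enc hx⟩
  refine ⟨fun s => ⨆ t : {t : HigSeq k // enc t ≤ s}, HigSeq.value k t.1, fun s s' hs => ?_,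
    fun γ hγ => ?_⟩
  · exact Ordinal.iSup_le fun t => Ordinal.le_iSup
      (fun t : {t : HigSeq k // enc t ≤ s'} => HigSeq.value k t.1) ⟨t.1, t.2.trans hs⟩
  · obtain ⟨t, rfl⟩ := HigSeq.exists_value_eq hγ
    refine ⟨enc t, le_antisymm (Ordinal.iSup_le fun t' => HigSeq.value_mono ?_)
      (Ordinal.le_iSup
        (fun u : {u : HigSeq k // enc u ≤ enc t} => HigSeq.value k u.1) ⟨t, le_rfl⟩)⟩
    have := le_iff_weakGap.1 t'.2
    rw [henc, henc] at this
    exact HigSeq.le_of_weakGap_enc this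

end RestrictedSeq

theorem mainTheorem6 (n : ℕ) (hn : 1 ≤ n) :
    WellQuasiOrderedLE (RestrictedSeq n) ∧
      maxOrderType (RestrictedSeq n) = omegaTower.{0} (2 * n - 1) := by
  obtain ⟨k, rfl⟩ := Nat.exists_eq_add_of_le' hn
  have hk : 2 * (k + 1) - 1 = 2 * k + 1 := by omega
  have hb := RestrictedSeq.residualBound.{0} k
  have hw : WellQuasiOrderedLE (RestrictedSeq (k + 1)) := ⟨hb.wellQuasiOrdered⟩
  obtain ⟨h, hm, hs⟩ := RestrictedSeq.exists_monotone k
  rw [hk]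
  refine ⟨hw, le_antisymm (csSup_le' ?_) (le_maxOrderType h hm hs)⟩
  rintro _ ⟨r, hr, hle, rfl⟩
  exact hb.type_le r hle
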